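/- Let $\mathbb{F}_\infty$ be the free group on countably infinitely many generators $g_1,g_2,\dots$, with identity $e$. Every $g\in\mathbb{F}_\infty$ has a unique reduced form $g=g_{i_1}^{k_1}g_{i_2}^{k_2}\cdots g_{i_n}^{k_n}$ with $n\ge 0$, $k_j\in\mathbb{Z}\setminus\{0\}$ and $i_j\neq i_{j+1}$; put $\|g\|_2=\bigl(\sum_{j=1}^n|k_j|^2\bigr)^{1/2}$, so that $\|g\|_2^2$ is a nonnegative integer. A function $\psi:\mathbb{F}_\infty\to\mathbb{C}$ is called $\ell^2$-radial if $\psi(g)$ depends only on $\|g\|_2$. It is called conditionally negative definite if $\psi(g^{-1})=\overline{\psi(g)}$ for all $g$ and, for all $n\in\mathbb{N}$, $x_1,\dots,x_n\in\mathbb{F}_\infty$ and $c_1,\dots,c_n\in\mathbb{C}$ with $\sum_{j}c_j=0$, one has $\sum_{j,k=1}^n c_j\overline{c_k}\,\psi(x_j^{-1}x_k)\le 0$. **Theorem.** Let $\psi:\mathbb{F}_\infty\to\mathbb{C}$ be an $\ell^2$-radial function with $\psi(e)=0$. Then the following are equivalent: 1. $\psi$ is conditionally negative definite on $\mathbb{F}_\infty$.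 2. There is a finite positive Borel measure $\nu$ on $[-1,1]$ such that, for all $g\in\mathbb{F}_\infty$, $$\psi(g)=\int_{[-1,1]}\frac{1-s^{\|g\|_2^2}}{1-s}\,d\nu(s),$$ where the integrand is given at $s=1$ its limit value $\|g\|_2^2$. Moreover, the finite positive Borel measure $\nu$ in (2) is uniquely determined by $\psi$. -/

import Mathlib

/-- The exponents `k₁, …, kₙ` of the reduced form `g = g_{i₁}^{k₁} ⋯ g_{iₙ}^{kₙ}`
(`i_j ≠ i_{j+1}`, `k_j ≠ 0`) of an element of the free group on generators indexed by `ℕ`: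
the reduced word, a list of letters `(i, true) = g_i` and `(i, false) = g_i⁻¹`, is cut into its
maximal blocks of letters with the same generator, and each block contributes the sum of the
signs of its letters. -/
def syllableExponents (g : FreeGroup ℕ) : List ℤ :=
  (g.toWord.splitBy fun a b => a.1 == b.1).map fun block =>
    (block.map fun a => if a.2 then (1 : ℤ) else -1).sum

/-- The square of the `ℓ²` length, the natural number `∑ |k_j|²`. -/
def l2LengthSq (g : FreeGroup ℕ) : ℕ :=
  ((syllableExponents g).map fun k => k.natAbs ^ 2).sum

/-- The `ℓ²` length `(∑ |k_j|²)^{1/2}`. -/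
noncomputable def l2Length (g : FreeGroup ℕ) : ℝ :=
  Real.sqrt (l2LengthSq g)

theorem sq_l2Length (g : FreeGroup ℕ) : l2Length g ^ 2 = (l2LengthSq g : ℝ) :=
  Real.sq_sqrt (Nat.cast_nonneg _)

/-- The value of `ψ` at `g` depends only on the `ℓ²` length of `g`. -/
def IsL2Radial (ψ : FreeGroup ℕ → ℂ) : Prop :=
  ∀ g h : FreeGroup ℕ, l2Length g = l2Length h → ψ g = ψ h

open scoped ComplexOrder ComplexConjugate in
/-- Conditionally negative definite functions on a group. In the order on `ℂ` used here,
`z ≤ 0` means that `z` is real and nonpositive. -/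
def IsCondNegDef {G : Type*} [Group G] (ψ : G → ℂ) : Prop :=
  (∀ g : G, ψ g⁻¹ = conj (ψ g)) ∧
  ∀ (n : ℕ) (x : Fin n → G) (c : Fin n → ℂ), ∑ j, c j = 0 →
    ∑ j, ∑ k, c j * conj (c k) * ψ ((x j)⁻¹ * x k) ≤ 0

/-- The function `s ↦ (1 - s ^ m) / (1 - s)`, extended continuously by the value `m` at
`s = 1`. -/
noncomputable def levyKernel (m : ℕ) (s : ℝ) : ℝ :=
  if s = 1 then (m : ℝ) else (1 - s ^ m) / (1 - s)

/-- `ψ g = ∫_{[-1,1]} (1 - s ^ (‖g‖₂²)) / (1 - s) dν(s)` for every `g`. -/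
def HasLevyKhintchineForm (ψ : FreeGroup ℕ → ℂ)
    (ν : MeasureTheory.Measure (Set.Icc (-1 : ℝ) 1)) : Prop :=
  ∀ g : FreeGroup ℕ, ψ g = ((∫ s, levyKernel (l2LengthSq g) (s : ℝ) ∂ν : ℝ) : ℂ)

/-! Write m = ‖g‖₂². The squared length comes from a Hilbert space: the affine action in which g_i
translates by the indicator of the coset ⟨g_i⟩ has a cocycle b with ‖b(y) - b(x)‖² = ‖x⁻¹y‖₂²
(`FreeGroup.hasSum_sq_cocycle_sub`), because g_i fixes that coset and exponents add up there before
being squared. Gaussian characteristic functions then make s^m positive definite for 0 < s ≤ 1, and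
the character g_i ↦ -1 carries this to negative s. Hence (1 - s^m)/(1 - s) is conditionally negative
definite, and so is every mixture.

Conversely, ψ(g) = φ(m). Testing ψ on products of many distinct generators gives a linear functional
Φ : X^m ↦ φ(m) with Φ(p² + q² + 2pqX²) ≤ 0 whenever p(1) + q(1) = 0. The pairs ((1 - X)q, 0) and (q,
-q) show that L(p) = Φ((X - 1)p) is nonnegative on all (1 - X)q² and (1 + X)q², which suffices for L
to be integration against a measure ν on [-1, 1]. Since (X - 1)(1 + ⋯ + X^(m-1)) = X^m - 1 and φ(0)
= 0, this ν represents ψ. Its moments are φ(m + 1) - φ(m), whence uniqueness. -/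

/-! ### Syllables of words -/

/-- The sum of the signs of the letters of a word. -/
def signSum (L : List (ℕ × Bool)) : ℤ :=
  (L.map fun a => if a.2 then (1 : ℤ) else -1).sum

/-- The sum of the squares of the exponents of the syllables of a (not necessarily reduced)
word. -/
def syllableSqSum (L : List (ℕ × Bool)) : ℤ :=
  ((L.splitBy fun a b => a.1 == b.1).map fun block => signSum block ^ 2).sum

/-- The exponent of the initial syllable of a word if its generator is the `i`-th one, and `0`
otherwise. -/
def headExponent (i : ℕ) (L : List (ℕ × Bool)) : ℤ :=
  signSum (L.takeWhile fun a => a.1 == i)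

theorem signSum_cons (a : ℕ × Bool) (L : List (ℕ × Bool)) :
    signSum (a :: L) = (if a.2 then (1 : ℤ) else -1) + signSum L := by
  simp [signSum]

theorem l2LengthSq_eq_syllableSqSum (g : FreeGroup ℕ) :
    (l2LengthSq g : ℤ) = syllableSqSum g.toWord := by
  simp only [l2LengthSq, syllableExponents, syllableSqSum, List.map_map, Nat.cast_list_sum]
  congr 1
  refine List.map_congr_left fun B _ => ?_
  simp [signSum, Function.comp_def]

theorem headExponent_cons_self (i : ℕ) (e : Bool) (L : List (ℕ × Bool)) :
    headExponent i ((i, e) :: L) = (if e then (1 : ℤ) else -1) + headExponent i L := by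
  simp [headExponent, signSum_cons]

theorem headExponent_cons_of_ne {i j : ℕ} (h : j ≠ i) (e : Bool) (L : List (ℕ × Bool)) :
    headExponent i ((j, e) :: L) = 0 := by
  simp [headExponent, h, signSum]

theorem List.splitBy_append_of_forall_eq {i : ℕ} {B D : List (ℕ × Bool)} (hB : B ≠ [])
    (hBi : ∀ a ∈ B, a.1 = i) (hD : ∀ a ∈ D.head?, a.1 ≠ i) :
    (B ++ D).splitBy (fun a b => a.1 == b.1) = B :: D.splitBy fun a b => a.1 == b.1 := by
  rw [List.splitBy_append, List.splitBy_of_isChain hB]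
  · rfl
  · refine List.Pairwise.isChain (List.pairwise_of_forall_mem_list fun a ha b hb => ?_)
    simp [hBi a ha, hBi b hb]
  · intro x hx y hy
    rw [hBi x (List.mem_of_mem_getLast? hx)]
    simpa using (hD y hy).symm

/-- A new first letter turns the leading exponent k (0 if the word starts with another generator)
into k ± 1, and (k ± 1)² = k² ± 2k + 1. -/
theorem syllableSqSum_cons (i : ℕ) (e : Bool) (L : List (ℕ × Bool)) :
    syllableSqSum ((i, e) :: L) =
      syllableSqSum L + 2 * (if e then (1 : ℤ) else -1) * headExponent i L + 1 := by
  have key : ∀ B D : List (ℕ × Bool), (∀ a ∈ B, a.1 = i) → (∀ a ∈ D.head?, a.1 ≠ i) →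
      syllableSqSum (B ++ D) = signSum B ^ 2 + syllableSqSum D := by
    intro B D hB hD
    by_cases h : B = []
    · simp [h, signSum]
    · simp [syllableSqSum, List.splitBy_append_of_forall_eq h hB hD]
  set B := L.takeWhile fun a => a.1 == i with hBdef
  set D := L.dropWhile fun a => a.1 == i with hDdef
  have hL : L = B ++ D := (List.takeWhile_append_dropWhile).symm
  have hB : ∀ a ∈ B, a.1 = i := fun a ha => by
    simpa using List.mem_takeWhile_imp ha
  have hD : ∀ a ∈ D.head?, a.1 ≠ i := fun a ha => by
    have := List.head?_dropWhile_not (fun a : ℕ × Bool => a.1 == i) L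
    rw [← hDdef] at this
    rw [Option.mem_def] at ha
    simpa [ha] using this
  have h1 := key ((i, e) :: B) D (by simpa using fun a b h => hB (a, b) h) hD
  have h2 := key B D hB hD
  rw [← hL] at h2
  rw [List.cons_append, ← hL, signSum_cons] at h1
  rw [h1, h2, headExponent, ← hBdef]
  cases e <;> simp <;> ring

theorem syllableSqSum_of_isChain_ne {L : List (ℕ × Bool)}
    (hL : L.IsChain fun a b => a.1 ≠ b.1) : syllableSqSum L = L.length := by
  induction L with
  | nil => rfl
  | cons a L ih =>
    obtain ⟨i, e⟩ := a
    rw [syllableSqSum_cons, ih hL.tail]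
    have : headExponent i L = 0 := by
      cases L with
      | nil => rfl
      | cons b L =>
        exact headExponent_cons_of_ne (List.isChain_cons_cons.1 hL).1.symm _ _
    simp [this]

theorem l2LengthSq_mk_of_isChain_ne {L : List (ℕ × Bool)}
    (hL : L.IsChain fun a b => a.1 ≠ b.1) : l2LengthSq (FreeGroup.mk L) = L.length := by
  have hred : FreeGroup.IsReduced L := hL.imp fun a b h h' => absurd h' h
  have := l2LengthSq_eq_syllableSqSum (FreeGroup.mk L)
  rw [FreeGroup.toWord_mk, hred.reduce_eq, syllableSqSum_of_isChain_ne hL] at this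
  exact_mod_cast this

/-- Since k² ≡ k mod 2, both sides are the parity of the number of letters. -/
theorem neg_one_pow_l2LengthSq (g : FreeGroup ℕ) :
    (-1 : ℤˣ) ^ l2LengthSq g = FreeGroup.lift (fun _ => (-1 : ℤˣ)) g := by
  have key : ∀ L : List (ℕ × Bool),
      (-1 : ℤˣ) ^ syllableSqSum L = FreeGroup.lift (fun _ => (-1 : ℤˣ)) (FreeGroup.mk L) := by
    intro L
    induction L with
    | nil => rfl
    | cons a L ih =>
      obtain ⟨i, e⟩ := a
      rw [syllableSqSum_cons, mul_assoc, zpow_add, zpow_add, zpow_mul, ih]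
      simp only [FreeGroup.lift_mk, List.map_cons, List.prod_cons]
      cases e <;> simp [mul_comm]
  have := key g.toWord
  rwa [← l2LengthSq_eq_syllableSqSum, FreeGroup.mk_toWord, zpow_natCast] at this

/-! ### A cocycle realizing the ℓ² length -/

namespace FreeGroup

/-- The disjoint union over the generators `g_i` of the sets of left cosets of `⟨g_i⟩`. -/
abbrev GenCosets : Type :=
  Σ i : ℕ, FreeGroup ℕ ⧸ Subgroup.zpowers (of i)

/-- The coset `⟨g_i⟩` itself. -/
def baseCoset (i : ℕ) : GenCosets := ⟨i, ((1 : FreeGroup ℕ) : FreeGroup ℕ ⧸ _)⟩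

theorem of_smul_baseCoset (i : ℕ) : of i • baseCoset i = baseCoset i := by
  rw [baseCoset, Sigma.smul_mk, MulAction.Quotient.smul_coe]
  congr 1
  refine QuotientGroup.eq.2 ?_
  simp

open Classical in
/-- The affine action of the `i`-th generator on functions on the cosets. -/
noncomputable def genAffine (i : ℕ) : Equiv.Perm (GenCosets → ℝ) where
  toFun v := fun t => (if t = baseCoset i then (1 : ℝ) else 0) + v ((of i)⁻¹ • t)
  invFun v := fun t => v (of i • t) - (if of i • t = baseCoset i then (1 : ℝ) else 0)
  left_inv v := by funext t; simp
  right_inv v := by funext t; simp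

/-- The cocycle of the free group sending the `i`-th generator to the indicator of `⟨g_i⟩`. -/
noncomputable def cocycle (g : FreeGroup ℕ) : GenCosets → ℝ :=
  lift genAffine g 0

/-- The linear part of the affine action is translation of functions on cosets; the cocycle is its
translation part. -/
theorem lift_genAffine (g : FreeGroup ℕ) (v : GenCosets → ℝ) (t : GenCosets) :
    lift genAffine g v t = cocycle g t + v (g⁻¹ • t) := by
  induction g using FreeGroup.induction_on generalizing v t with
  | C1 => simp [cocycle]
  | of i => simp [cocycle, genAffine]
  | inv_of i _ =>
    simp only [cocycle, _root_.map_inv, lift_apply_of, Equiv.Perm.inv_def]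
    simp [genAffine]
    ring
  | mul x y hx hy =>
    simp only [_root_.map_mul, Equiv.Perm.mul_apply, cocycle, mul_inv_rev, mul_smul] at *
    rw [hx, hy, hx (lift genAffine y 0)]
    ring

theorem cocycle_mul (g h : FreeGroup ℕ) (t : GenCosets) :
    cocycle (g * h) t = cocycle g t + cocycle h (g⁻¹ • t) := by
  conv_lhs => rw [cocycle, _root_.map_mul, Equiv.Perm.mul_apply]
  exact lift_genAffine g _ t

theorem cocycle_one (t : GenCosets) : cocycle 1 t = 0 := by simp [cocycle]

open Classical in
theorem cocycle_mk_singleton (i : ℕ) (e : Bool) (t : GenCosets) :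
    cocycle (mk [(i, e)]) t = if t = baseCoset i then (if e then (1 : ℝ) else -1) else 0 := by
  have h1 : cocycle (of i) t = if t = baseCoset i then (1 : ℝ) else 0 := by
    simp [cocycle, genAffine]
  cases e with
  | true => simpa [of] using h1
  | false =>
    have h2 := cocycle_mul (of i) (of i)⁻¹ (of i • t)
    have h3 : (mk [(i, false)] : FreeGroup ℕ) = (of i)⁻¹ := by simp [of, inv_mk, invRev]
    have h4 : (of i • t = baseCoset i) ↔ t = baseCoset i := by
      conv_lhs => rw [← of_smul_baseCoset i]
      exact smul_left_cancel_iff _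
    rw [mul_inv_cancel, cocycle_one, inv_smul_smul] at h2
    have h5 : cocycle (of i) (of i • t) = if t = baseCoset i then (1 : ℝ) else 0 := by
      simp [cocycle, genAffine, h4]
    rw [h3]
    rw [h5] at h2
    split_ifs at h2 ⊢ <;> first | contradiction | linarith

theorem mk_singleton_inv_smul_baseCoset (i : ℕ) (e : Bool) :
    (mk [(i, e)])⁻¹ • baseCoset i = baseCoset i := by
  have h := of_smul_baseCoset i
  rw [inv_smul_eq_iff]
  cases e with
  | true => exact h.symm
  | false =>
    have h3 : (mk [(i, false)] : FreeGroup ℕ) = (of i)⁻¹ := by simp [of, inv_mk, invRev]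
    rw [h3, eq_inv_smul_iff, h]

open Classical in
theorem cocycle_mk_cons (i : ℕ) (e : Bool) (L : List (ℕ × Bool)) (t : GenCosets) :
    cocycle (mk ((i, e) :: L)) t =
      (if t = baseCoset i then (if e then (1 : ℝ) else -1) else 0) +
        cocycle (mk L) ((mk [(i, e)])⁻¹ • t) := by
  have : (mk ((i, e) :: L) : FreeGroup ℕ) = mk [(i, e)] * mk L := by simp [mul_mk]
  rw [this, cocycle_mul, cocycle_mk_singleton]

/-- Each letter of the word contributes ±1 at the coset of the prefix that precedes it. -/
theorem exists_prefix_of_cocycle_mk_ne_zero (L : List (ℕ × Bool)) (i : ℕ)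
    (C : FreeGroup ℕ ⧸ Subgroup.zpowers (of i)) (h : cocycle (mk L) ⟨i, C⟩ ≠ 0) :
    ∃ P : List (ℕ × Bool), P <+: L ∧ C = (mk P : FreeGroup ℕ) := by
  classical
  induction L generalizing C with
  | nil => exact absurd (cocycle_one _) h
  | cons a L ih =>
    obtain ⟨j, e⟩ := a
    rw [cocycle_mk_cons] at h
    by_cases h1 : (⟨i, C⟩ : GenCosets) = baseCoset j
    · obtain ⟨rfl, h2⟩ := Sigma.mk.inj_iff.1 h1
      exact ⟨[], List.nil_prefix, eq_of_heq h2⟩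
    · rw [if_neg h1, zero_add, Sigma.smul_mk] at h
      obtain ⟨P, hP, hC⟩ := ih _ h
      refine ⟨(j, e) :: P, by simpa using hP, ?_⟩
      rw [inv_smul_eq_iff, MulAction.Quotient.smul_coe, smul_eq_mul, mul_mk] at hC
      exact hC

theorem fst_eq_of_mem_toWord_of_zpow {i : ℕ} {n : ℤ} {a : ℕ × Bool}
    (h : a ∈ (of i ^ n).toWord) : a.1 = i := by
  cases n with
  | ofNat n =>
    rw [Int.ofNat_eq_natCast, zpow_natCast, toWord_of_pow] at h
    rw [List.eq_of_mem_replicate h]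
  | negSucc n =>
    rw [zpow_negSucc, toWord_inv, toWord_of_pow] at h
    simp only [invRev, List.map_replicate, List.reverse_replicate] at h
    rw [List.eq_of_mem_replicate h]

/-- Only the leading syllable can contribute at ⟨g_i⟩. If the word starts with another generator, a
contribution there would make a nonempty reduced prefix, with that first letter, a power of g_i. -/
theorem cocycle_mk_baseCoset {L : List (ℕ × Bool)} (hL : IsReduced L) (i : ℕ) :
    cocycle (mk L) (baseCoset i) = headExponent i L := by
  classical
  induction L with
  | nil => exact (cocycle_one _).trans (by simp [headExponent, signSum])
  | cons a L ih =>
    obtain ⟨j, e⟩ := a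
    have ih := ih (List.IsChain.tail hL)
    rw [cocycle_mk_cons]
    by_cases hij : j = i
    · subst hij
      rw [mk_singleton_inv_smul_baseCoset, ih, headExponent_cons_self]
      cases e <;> simp
    · rw [headExponent_cons_of_ne hij, if_neg (fun h => hij (congrArg Sigma.fst h).symm), zero_add,
        Int.cast_zero]
      by_contra h
      rw [baseCoset, Sigma.smul_mk] at h
      obtain ⟨P, hP, hC⟩ := exists_prefix_of_cocycle_mk_ne_zero _ _ _ h
      rw [inv_smul_eq_iff, MulAction.Quotient.smul_coe, smul_eq_mul, mul_mk] at hC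
      obtain ⟨n, hn⟩ := QuotientGroup.eq.1 hC
      have hr : IsReduced ((j, e) :: P) :=
        hL.infix (List.IsPrefix.isInfix (by simpa using hP))
      have hw : (of i ^ n).toWord = (j, e) :: P := by
        simp only [inv_one, one_mul, List.singleton_append] at hn
        rw [hn, toWord_mk, hr.reduce_eq]
      exact hij (fst_eq_of_mem_toWord_of_zpow (a := (j, e)) (hw ▸ List.mem_cons_self))

/-- Prepending a letter translates the cocycle and adds ±1 at one coset, where its value is the head
exponent. The squared norm thus obeys the recursion of `syllableSqSum_cons`. -/
theorem hasSum_sq_cocycle_mk {L : List (ℕ × Bool)} (hL : IsReduced L) :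
    HasSum (fun t => cocycle (mk L) t ^ 2) (syllableSqSum L) := by
  classical
  induction L with
  | nil =>
    have : (mk [] : FreeGroup ℕ) = 1 := rfl
    simp [this, cocycle_one, syllableSqSum, hasSum_zero]
  | cons a L ih =>
    obtain ⟨i, e⟩ := a
    have hL' : IsReduced L := List.IsChain.tail hL
    have h1 := ((MulAction.toPerm (mk [(i, e)])⁻¹).hasSum_iff
      (f := fun t => cocycle (mk L) t ^ 2)).2 (ih hL')
    have h2 := hasSum_ite_eq (baseCoset i)
      (2 * (if e then (1 : ℝ) else -1) * headExponent i L + 1)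
    convert h1.add h2 using 1
    · funext t
      rw [cocycle_mk_cons]
      by_cases ht : t = baseCoset i
      · subst ht
        simp only [Function.comp, MulAction.toPerm_apply, mk_singleton_inv_smul_baseCoset,
          cocycle_mk_baseCoset hL']
        cases e <;> simp <;> ring
      · simp [ht]
    · rw [syllableSqSum_cons]
      cases e <;> simp <;> ring

theorem hasSum_sq_cocycle (g : FreeGroup ℕ) :
    HasSum (fun t => cocycle g t ^ 2) (l2LengthSq g) := by
  have := hasSum_sq_cocycle_mk (isReduced_toWord (x := g))
  rw [mk_toWord, ← l2LengthSq_eq_syllableSqSum] at this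
  exact_mod_cast this

theorem finite_support_cocycle (g : FreeGroup ℕ) : (Function.support (cocycle g)).Finite := by
  classical
  rw [← mk_toWord (x := g)]
  induction g.toWord with
  | nil =>
    exact Set.finite_empty.subset fun t ht => ht (cocycle_one t)
  | cons a L ih =>
    obtain ⟨i, e⟩ := a
    refine ((Set.finite_singleton (baseCoset i)).union
      (ih.preimage (f := fun t => (mk [(i, e)])⁻¹ • t) (MulAction.injective _).injOn)).subset ?_
    intro t ht
    by_contra h
    simp only [Set.mem_union, Set.mem_singleton_iff, Set.mem_preimage, Function.mem_support,
      not_or, not_not] at h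
    exact ht (by rw [cocycle_mk_cons, if_neg h.1, h.2, add_zero])

/-- The cocycle identity says that b(y) - b(x) is the translate of b(x⁻¹y) by x, and translation is
isometric. -/
theorem hasSum_sq_cocycle_sub (x y : FreeGroup ℕ) :
    HasSum (fun t => (cocycle y t - cocycle x t) ^ 2) (l2LengthSq (x⁻¹ * y)) := by
  convert ((MulAction.toPerm x⁻¹).hasSum_iff (f := fun t => cocycle (x⁻¹ * y) t ^ 2)).2
    (hasSum_sq_cocycle _) using 2 with t
  have := cocycle_mul x (x⁻¹ * y) t
  rw [mul_inv_cancel_left] at this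
  simp [this]

theorem l2LengthSq_inv (g : FreeGroup ℕ) : l2LengthSq g⁻¹ = l2LengthSq g := by
  have h1 := hasSum_sq_cocycle_sub g 1
  have h2 := hasSum_sq_cocycle_sub 1 g
  simp only [cocycle_one, mul_one, zero_sub, neg_sq, inv_one, one_mul, sub_zero] at h1 h2
  exact_mod_cast h1.unique h2

end FreeGroup

/-! ### Positive definiteness of powers of s -/

-- The sum is the expectation of |∑ c_j exp(i⟨Z, v_j⟩)|² for a standard Gaussian vector Z.
open scoped ComplexOrder ComplexConjugate in
theorem ProbabilityTheory.sum_mul_conj_mul_exp_neg_sq_norm_sub_nonneg {E : Type*}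
    [NormedAddCommGroup E] [InnerProductSpace ℝ E] [FiniteDimensional ℝ E] [MeasurableSpace E]
    [BorelSpace E] {n : ℕ} (v : Fin n → E) (c : Fin n → ℂ) :
    0 ≤ ∑ j, ∑ k, c j * conj (c k) * Complex.exp (-‖v j - v k‖ ^ 2 / 2) := by
  have hint : ∀ j k, MeasureTheory.Integrable
      (fun x => c j * conj (c k) * Complex.exp (inner ℝ x (v j - v k) * Complex.I))
      (stdGaussian E) := by
    intro j k
    refine MeasureTheory.Integrable.const_mul ?_ _
    refine (MeasureTheory.integrable_const (1 : ℝ)).mono' (by fun_prop) (.of_forall fun x => ?_)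
    rw [Complex.norm_exp_ofReal_mul_I]
  have h : ∑ j, ∑ k, c j * conj (c k) * Complex.exp (-‖v j - v k‖ ^ 2 / 2) =
      ∫ x, ((‖∑ j, c j * Complex.exp (inner ℝ x (v j) * Complex.I)‖ ^ 2 : ℝ) : ℂ)
        ∂(stdGaussian E) := by
    have h1 : ∀ x : E, ((‖∑ j, c j * Complex.exp (inner ℝ x (v j) * Complex.I)‖ ^ 2 : ℝ) : ℂ) =
        ∑ j, ∑ k, c j * conj (c k) * Complex.exp (inner ℝ x (v j - v k) * Complex.I) := by
      intro x
      rw [Complex.ofReal_pow, ← Complex.mul_conj', map_sum, Finset.sum_mul_sum]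
      refine Finset.sum_congr rfl fun j _ => Finset.sum_congr rfl fun k _ => ?_
      rw [map_mul, ← Complex.exp_conj, mul_mul_mul_comm, ← Complex.exp_add, inner_sub_right]
      simp only [map_mul, Complex.conj_ofReal, Complex.conj_I, mul_neg, ← sub_eq_add_neg, ← sub_mul,
        Complex.ofReal_sub]
    simp_rw [h1]
    rw [MeasureTheory.integral_finsetSum _ fun j _ =>
      MeasureTheory.integrable_finsetSum _ fun k _ => hint j k]
    refine Finset.sum_congr rfl fun j _ => ?_
    rw [MeasureTheory.integral_finsetSum _ fun k _ => hint j k]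
    refine Finset.sum_congr rfl fun k _ => ?_
    rw [MeasureTheory.integral_const_mul, ← charFun_stdGaussian, MeasureTheory.charFun_apply]
  rw [h, integral_complex_ofReal, Complex.zero_le_real]
  exact MeasureTheory.integral_nonneg fun x => by positivity

open FreeGroup

open scoped ComplexOrder ComplexConjugate in
theorem sum_mul_conj_mul_pow_l2LengthSq_nonneg_of_pos {s : ℝ} (h0 : 0 < s) (h1 : s ≤ 1) {n : ℕ}
    (x : Fin n → FreeGroup ℕ) (c : Fin n → ℂ) :
    0 ≤ ∑ j, ∑ k, c j * conj (c k) * (s : ℂ) ^ l2LengthSq ((x j)⁻¹ * x k) := by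
  classical
  -- With this scaling, exp(-r²m/2) = s^m.
  set r := √(-2 * Real.log s)
  have hr : r ^ 2 = -2 * Real.log s :=
    Real.sq_sqrt (by have := Real.log_nonpos h0.le h1; linarith)
  have hfin : (⋃ j, Function.support (cocycle (x j))).Finite :=
    Set.finite_iUnion fun j => finite_support_cocycle (x j)
  set T := hfin.toFinset
  let v : Fin n → EuclideanSpace ℝ T := fun j => WithLp.toLp 2 fun t => r * cocycle (x j) t
  have hv : ∀ j k, ‖v j - v k‖ ^ 2 = r ^ 2 * l2LengthSq ((x j)⁻¹ * x k) := by
    intro j k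
    have h2 : HasSum (fun t => (cocycle (x k) t - cocycle (x j) t) ^ 2)
        (∑ t ∈ T, (cocycle (x k) t - cocycle (x j) t) ^ 2) := by
      refine hasSum_sum_of_ne_finset_zero fun t ht => ?_
      have : ∀ j, cocycle (x j) t = 0 := by
        simpa [T] using ht
      simp [this]
    rw [← h2.unique (hasSum_sq_cocycle_sub (x j) (x k)), EuclideanSpace.norm_sq_eq,
      Finset.mul_sum, ← Finset.sum_coe_sort T]
    refine Finset.sum_congr rfl fun t _ => ?_
    simp only [v, PiLp.sub_apply, Real.norm_eq_abs, sq_abs]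
    ring
  convert ProbabilityTheory.sum_mul_conj_mul_exp_neg_sq_norm_sub_nonneg v c using 6 with j _ k _
  have h3 : (s : ℂ) ^ l2LengthSq ((x j)⁻¹ * x k) =
      ((Real.exp (-(‖v j - v k‖ ^ 2) / 2) : ℝ) : ℂ) := by
    rw [hv, hr, ← Complex.ofReal_pow]
    congr 1
    rw [show -(-2 * Real.log s * l2LengthSq ((x j)⁻¹ * x k)) / 2 =
      l2LengthSq ((x j)⁻¹ * x k) * Real.log s by ring, Real.exp_nat_mul, Real.exp_log h0]
  rw [h3]
  push_cast
  ring_nf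

open scoped ComplexOrder ComplexConjugate in
theorem sum_mul_conj_mul_pow_l2LengthSq_nonneg_of_neg {s : ℝ} (h0 : s < 0) (h1 : -1 ≤ s) {n : ℕ}
    (x : Fin n → FreeGroup ℕ) (c : Fin n → ℂ) :
    0 ≤ ∑ j, ∑ k, c j * conj (c k) * (s : ℂ) ^ l2LengthSq ((x j)⁻¹ * x k) := by
  set χ : FreeGroup ℕ →* ℤˣ := FreeGroup.lift fun _ => (-1 : ℤˣ)
  refine (sum_mul_conj_mul_pow_l2LengthSq_nonneg_of_pos (s := -s) (by linarith) (by linarith) x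
    -- The sign (-1)^m at x_j⁻¹x_k factors as χ(x_j)χ(x_k), so it is absorbed into the coefficients.
    (fun j => c j * ((χ (x j) : ℤ) : ℂ))).trans_eq
    (Finset.sum_congr rfl fun j _ => Finset.sum_congr rfl fun k _ => ?_)
  have h2 : (-1 : ℂ) ^ l2LengthSq ((x j)⁻¹ * x k) = ((χ (x j) : ℤ) : ℂ) * ((χ (x k) : ℤ) : ℂ) := by
    have h3 := congrArg (fun u : ℤˣ => ((u : ℤ) : ℂ)) (neg_one_pow_l2LengthSq ((x j)⁻¹ * x k))
    rw [_root_.map_mul, _root_.map_inv, Int.units_inv_eq_self] at h3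
    simpa using h3
  rw [Complex.ofReal_neg, neg_pow (s : ℂ), h2]
  have h4 : ∀ u : ℤˣ, (((u : ℤ) : ℂ)) * ((u : ℤ) : ℂ) = 1 := fun u => by
    rcases Int.units_eq_one_or u with rfl | rfl <;> simp
  rw [_root_.map_mul, map_intCast]
  linear_combination (c j * conj (c k) * (s : ℂ) ^ l2LengthSq ((x j)⁻¹ * x k)) *
    (h4 (χ (x k)) + (((χ (x k) : ℤ) : ℂ)) * ((χ (x k) : ℤ) : ℂ) * h4 (χ (x j)))

/-! ### The integral form is conditionally negative definite -/

theorem levyKernel_eq_sum_pow (m : ℕ) (s : ℝ) : levyKernel m s = ∑ i ∈ Finset.range m, s ^ i := by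
  rw [levyKernel]
  split_ifs with h
  · simp [h]
  · rw [geom_sum_eq h, ← neg_div_neg_eq, neg_sub, neg_sub]

theorem continuous_levyKernel (m : ℕ) : Continuous (levyKernel m) := by
  simp_rw [funext (levyKernel_eq_sum_pow m)]
  fun_prop

open scoped ComplexOrder ComplexConjugate in
theorem sum_mul_conj_mul_levyKernel_nonpos {s : ℝ} (hs : s ∈ Set.Icc (-1 : ℝ) 1) {n : ℕ}
    (x : Fin n → FreeGroup ℕ) (c : Fin n → ℂ) (hc : ∑ j, c j = 0) :
    ∑ j, ∑ k, c j * conj (c k) * (levyKernel (l2LengthSq ((x j)⁻¹ * x k)) s : ℂ) ≤ 0 := by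
  have hcl : IsClosed {s : ℝ |
      ∑ j, ∑ k, c j * conj (c k) * (levyKernel (l2LengthSq ((x j)⁻¹ * x k)) s : ℂ) ≤ 0} := by
    refine isClosed_le ?_ continuous_const
    have := continuous_levyKernel
    fun_prop
  -- The points -1, 0 and 1 are recovered by continuity in s.
  have hsub : Set.Ioo (-1 : ℝ) 0 ∪ Set.Ioo 0 1 ⊆ {s : ℝ |
      ∑ j, ∑ k, c j * conj (c k) * (levyKernel (l2LengthSq ((x j)⁻¹ * x k)) s : ℂ) ≤ 0} := by
    intro s hs
    have hs1 : s < 1 := by rcases hs with hs | hs <;> linarith [hs.2]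
    have hpos : 0 ≤ ∑ j, ∑ k, c j * conj (c k) * (s : ℂ) ^ l2LengthSq ((x j)⁻¹ * x k) := by
      rcases hs with hs | hs
      · exact sum_mul_conj_mul_pow_l2LengthSq_nonneg_of_neg hs.2 hs.1.le x c
      · exact sum_mul_conj_mul_pow_l2LengthSq_nonneg_of_pos hs.1 hs.2.le x c
    -- As ∑ c_j = 0, the constant 1 in 1 - s^m drops out.
    have heq : ∑ j, ∑ k, c j * conj (c k) * (levyKernel (l2LengthSq ((x j)⁻¹ * x k)) s : ℂ) =
        -(((1 - s)⁻¹ : ℝ) *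
          ∑ j, ∑ k, c j * conj (c k) * (s : ℂ) ^ l2LengthSq ((x j)⁻¹ * x k)) := by
      have h0 : ∑ j, ∑ k, c j * conj (c k) = 0 := by
        rw [← Finset.sum_mul_sum, hc, zero_mul]
      rw [← sub_eq_zero, sub_neg_eq_add, ← mul_zero (((1 - s)⁻¹ : ℝ) : ℂ), ← h0, Finset.mul_sum,
        Finset.mul_sum, ← Finset.sum_add_distrib]
      refine Finset.sum_congr rfl fun j _ => ?_
      rw [Finset.mul_sum, Finset.mul_sum, ← Finset.sum_add_distrib]
      refine Finset.sum_congr rfl fun k _ => ?_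
      rw [levyKernel, if_neg hs1.ne]
      push_cast
      ring
    rw [Set.mem_ofPred_eq, heq, neg_nonpos]
    exact mul_nonneg (Complex.zero_le_real.2 (inv_nonneg.2 (by linarith))) hpos
  refine closure_minimal hsub hcl ?_
  rw [closure_union, closure_Ioo (by norm_num), closure_Ioo (by norm_num)]
  rcases le_total s 0 with h | h
  · exact Or.inl ⟨hs.1, h⟩
  · exact Or.inr ⟨h, hs.2⟩

theorem integrable_of_continuous_icc {ν : MeasureTheory.Measure (Set.Icc (-1 : ℝ) 1)}
    [MeasureTheory.IsFiniteMeasure ν] {f : Set.Icc (-1 : ℝ) 1 → ℝ} (hf : Continuous f) :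
    MeasureTheory.Integrable f ν :=
  hf.integrable_of_hasCompactSupport (HasCompactSupport.of_compactSpace f)

theorem integrable_levyKernel {ν : MeasureTheory.Measure (Set.Icc (-1 : ℝ) 1)}
    [MeasureTheory.IsFiniteMeasure ν] (m : ℕ) :
    MeasureTheory.Integrable (fun s : Set.Icc (-1 : ℝ) 1 => levyKernel m s) ν :=
  integrable_of_continuous_icc ((continuous_levyKernel m).comp continuous_subtype_val)

open scoped ComplexOrder ComplexConjugate in
theorem HasLevyKhintchineForm.isCondNegDef {ψ : FreeGroup ℕ → ℂ}
    {ν : MeasureTheory.Measure (Set.Icc (-1 : ℝ) 1)} [MeasureTheory.IsFiniteMeasure ν]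
    (h : HasLevyKhintchineForm ψ ν) : IsCondNegDef ψ := by
  refine ⟨fun g => by rw [h, h, l2LengthSq_inv, Complex.conj_ofReal], fun n x c hc => ?_⟩
  have hint : ∀ j k, MeasureTheory.Integrable (fun s : Set.Icc (-1 : ℝ) 1 =>
      c j * conj (c k) * (levyKernel (l2LengthSq ((x j)⁻¹ * x k)) s : ℂ)) ν := fun j k =>
    ((integrable_levyKernel _).ofReal).const_mul _
  have h1 : ∑ j, ∑ k, c j * conj (c k) * ψ ((x j)⁻¹ * x k) = ∫ s : Set.Icc (-1 : ℝ) 1,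
      ∑ j, ∑ k, c j * conj (c k) * (levyKernel (l2LengthSq ((x j)⁻¹ * x k)) s : ℂ) ∂ν := by
    rw [MeasureTheory.integral_finsetSum _ fun j _ =>
      MeasureTheory.integrable_finsetSum _ fun k _ => hint j k]
    refine Finset.sum_congr rfl fun j _ => ?_
    rw [MeasureTheory.integral_finsetSum _ fun k _ => hint j k]
    refine Finset.sum_congr rfl fun k _ => ?_
    rw [MeasureTheory.integral_const_mul, h, integral_complex_ofReal]
  have h2 : ∀ s : Set.Icc (-1 : ℝ) 1, ∑ j, ∑ k, c j * conj (c k) *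
      (levyKernel (l2LengthSq ((x j)⁻¹ * x k)) s : ℂ) = ((∑ j, ∑ k, c j * conj (c k) *
      (levyKernel (l2LengthSq ((x j)⁻¹ * x k)) s : ℂ)).re : ℂ) := fun s =>
    Complex.ext rfl (Complex.nonpos_iff.1 (sum_mul_conj_mul_levyKernel_nonpos s.2 x c hc)).2
  rw [h1, MeasureTheory.integral_congr_ae (.of_forall h2), integral_complex_ofReal]
  refine Complex.real_le_real.2 (MeasureTheory.integral_nonpos fun s => ?_)
  exact (Complex.nonpos_iff.1 (sum_mul_conj_mul_levyKernel_nonpos s.2 x c hc)).1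

/-! ### Uniqueness of the measure -/

theorem exists_l2LengthSq_eq (m : ℕ) : ∃ g : FreeGroup ℕ, l2LengthSq g = m := by
  refine ⟨mk ((List.range m).map fun i => (i, true)), ?_⟩
  rw [l2LengthSq_mk_of_isChain_ne]
  · simp
  · refine List.Pairwise.isChain ?_
    rw [List.pairwise_map]
    exact List.nodup_range

/-- A finite measure on `[-1, 1]` is determined by its moments. -/
theorem MeasureTheory.Measure.ext_of_moments_icc
    {ν₁ ν₂ : MeasureTheory.Measure (Set.Icc (-1 : ℝ) 1)}
    [MeasureTheory.IsFiniteMeasure ν₁] [MeasureTheory.IsFiniteMeasure ν₂]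
    (h : ∀ m : ℕ, ∫ s, (s : ℝ) ^ m ∂ν₁ = ∫ s, (s : ℝ) ^ m ∂ν₂) : ν₁ = ν₂ := by
  have hcont : ∀ (ν : MeasureTheory.Measure (Set.Icc (-1 : ℝ) 1))
      [MeasureTheory.IsFiniteMeasure ν],
      Continuous fun f : C(Set.Icc (-1 : ℝ) 1, ℝ) => ∫ s, f s ∂ν := by
    intro ν _
    refine (MeasureTheory.continuous_integral.comp
      (ContinuousMap.toLp (E := ℝ) 1 ν ℝ).continuous).congr fun f => ?_
    exact MeasureTheory.integral_congr_ae (ContinuousMap.coeFn_toLp ν f)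
  have hpoly : ∀ f ∈ polynomialFunctions (Set.Icc (-1 : ℝ) 1),
      ∫ s, f s ∂ν₁ = ∫ s, f s ∂ν₂ := by
    rintro _ ⟨p, -, rfl⟩
    have h1 : ∀ s : Set.Icc (-1 : ℝ) 1, (Polynomial.toContinuousMapOnAlgHom _ p) s =
        ∑ i ∈ Finset.range (p.natDegree + 1), p.coeff i * (s : ℝ) ^ i := fun s => by
      simp [Polynomial.eval_eq_sum_range]
    simp only [RingHom.coe_coe, h1]
    rw [MeasureTheory.integral_finsetSum _ fun i _ => integrable_of_continuous_icc (by fun_prop),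
      MeasureTheory.integral_finsetSum _ fun i _ => integrable_of_continuous_icc (by fun_prop)]
    refine Finset.sum_congr rfl fun i _ => ?_
    rw [MeasureTheory.integral_const_mul, MeasureTheory.integral_const_mul, h]
  refine MeasureTheory.ext_of_forall_integral_eq_of_IsFiniteMeasure fun f => ?_
  have hmem := continuousMap_mem_polynomialFunctions_closure (-1) 1 f.toContinuousMap
  have hsub : (polynomialFunctions (Set.Icc (-1 : ℝ) 1) : Set C(Set.Icc (-1 : ℝ) 1, ℝ)) ⊆
      {f | ∫ s, f s ∂ν₁ = ∫ s, f s ∂ν₂} := hpoly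
  exact closure_minimal hsub (isClosed_eq (hcont ν₁) (hcont ν₂)) hmem

theorem HasLevyKhintchineForm.measure_unique {ψ : FreeGroup ℕ → ℂ}
    {ν₁ ν₂ : MeasureTheory.Measure (Set.Icc (-1 : ℝ) 1)}
    [MeasureTheory.IsFiniteMeasure ν₁] [MeasureTheory.IsFiniteMeasure ν₂]
    (h₁ : HasLevyKhintchineForm ψ ν₁) (h₂ : HasLevyKhintchineForm ψ ν₂) : ν₁ = ν₂ := by
  have key : ∀ m, ∫ s, levyKernel m (s : ℝ) ∂ν₁ = ∫ s, levyKernel m (s : ℝ) ∂ν₂ := by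
    intro m
    obtain ⟨g, rfl⟩ := exists_l2LengthSq_eq m
    exact Complex.ofReal_injective ((h₁ g).symm.trans (h₂ g))
  refine MeasureTheory.Measure.ext_of_moments_icc fun m => ?_
  have hs : ∀ s : Set.Icc (-1 : ℝ) 1, (s : ℝ) ^ m = levyKernel (m + 1) s - levyKernel m s :=
    fun s => by simp [levyKernel_eq_sum_pow, Finset.sum_range_succ]
  simp_rw [hs]
  rw [MeasureTheory.integral_sub (integrable_levyKernel _) (integrable_levyKernel _),
    MeasureTheory.integral_sub (integrable_levyKernel _) (integrable_levyKernel _), key, key]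

/-! ### The moment problem on [-1, 1] -/

open Polynomial in
/-- A linear functional on real polynomials that is nonnegative on the products of squares with
`1 - X` and `1 + X` is nonnegative on the polynomials that are nonnegative on `[-1, 1]`. -/
theorem Polynomial.map_nonneg_of_eval_nonneg_icc (L : ℝ[X] →ₗ[ℝ] ℝ)
    (h₁ : ∀ q : ℝ[X], 0 ≤ L ((1 - X) * q ^ 2)) (h₂ : ∀ q : ℝ[X], 0 ≤ L ((1 + X) * q ^ 2))
    (p : ℝ[X]) (hp : ∀ s ∈ Set.Icc (-1 : ℝ) 1, 0 ≤ p.eval s) : 0 ≤ L p := by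
  have hsq : ∀ (L : ℝ[X] →ₗ[ℝ] ℝ), (∀ q : ℝ[X], 0 ≤ L ((1 - X) * q ^ 2)) →
      (∀ q : ℝ[X], 0 ≤ L ((1 + X) * q ^ 2)) → ∀ q, 0 ≤ L (q ^ 2) := by
    intro L h₁ h₂ q
    have h := add_nonneg (h₁ q) (h₂ q)
    rw [← map_add, show (1 - X) * q ^ 2 + (1 + X) * q ^ 2 = (2 : ℝ) • q ^ 2 by
      rw [two_smul]; ring, map_smul, smul_eq_mul] at h
    linarith
  have hprod : ∀ (L : ℝ[X] →ₗ[ℝ] ℝ), (∀ q : ℝ[X], 0 ≤ L ((1 - X) * q ^ 2)) →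
      (∀ q : ℝ[X], 0 ≤ L ((1 + X) * q ^ 2)) → ∀ q, 0 ≤ L ((1 - X) * (1 + X) * q ^ 2) := by
    intro L h₁ h₂ q
    have h := add_nonneg (h₁ ((1 + X) * q)) (h₂ ((1 - X) * q))
    rw [← map_add, show (1 - X) * ((1 + X) * q) ^ 2 + (1 + X) * ((1 - X) * q) ^ 2 =
      (2 : ℝ) • ((1 - X) * (1 + X) * q ^ 2) by
      rw [two_smul]; ring, map_smul, smul_eq_mul] at h
    linarith
  -- After division by X - a the sign of the quotient is known only off a; continuity supplies it at
  -- a.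
  have hdense : ∀ (q : ℝ[X]) (a : ℝ), (∀ s ∈ Set.Icc (-1 : ℝ) 1, s ≠ a → 0 ≤ q.eval s) →
      ∀ s ∈ Set.Icc (-1 : ℝ) 1, 0 ≤ q.eval s := by
    intro q a hq s hs
    have hcl : IsClosed {s | 0 ≤ q.eval s} := isClosed_le continuous_const q.continuous
    have h1 : Set.Ioo (-1 : ℝ) 1 ⊆ closure (Set.Ioo (-1 : ℝ) 1 ∩ {a}ᶜ) :=
      (dense_compl_singleton a).open_subset_closure_inter isOpen_Ioo
    have h2 : Set.Ioo (-1 : ℝ) 1 ∩ {a}ᶜ ⊆ {s | 0 ≤ q.eval s} := fun t ht =>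
      hq t (Set.Ioo_subset_Icc_self ht.1) ht.2
    have h3 := closure_minimal (h1.trans (closure_minimal h2 hcl)) hcl
    rw [closure_Ioo (by norm_num)] at h3
    exact h3 hs
  -- The functional varies in the induction: a factor f of p is moved into it, and L(f · ) must
  -- inherit both hypotheses.
  induction hn : p.natDegree using Nat.strong_induction_on generalizing L p with
  | _ n ih =>
    subst hn
    by_cases hdeg : p.natDegree = 0
    · rw [eq_C_of_natDegree_eq_zero hdeg] at hp ⊢
      have hc : 0 ≤ p.coeff 0 := by simpa using hp 0 (by norm_num)
      have h1 := hsq L h₁ h₂ 1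
      rw [← mul_one (C (p.coeff 0)), ← smul_eq_C_mul, map_smul]
      rw [one_pow] at h1
      exact mul_nonneg hc h1
    have hp0 : p ≠ 0 := fun h => hdeg (by simp [h])
    obtain ⟨z, hz⟩ := IsAlgClosed.exists_aeval_eq_zero ℂ p
      (fun h => hdeg (natDegree_eq_of_degree_eq_some h))
    by_cases him : z.im = 0
    · have hroot : p.eval z.re = 0 := by
        have : z = algebraMap ℝ ℂ z.re := Complex.ext rfl (by simpa using him)
        rw [this, aeval_algebraMap_apply] at hz
        simpa using hz
      set a := z.re
      obtain ⟨q, rfl⟩ := dvd_iff_isRoot.2 hroot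
      have hq0 : q ≠ 0 := right_ne_zero_of_mul hp0
      have hqdeg : ((X - C a) * q).natDegree = q.natDegree + 1 := by
        rw [natDegree_mul (X_sub_C_ne_zero a) hq0, natDegree_X_sub_C, add_comm]
      simp only [eval_mul, eval_sub, eval_X, eval_C] at hp
      rcases le_or_gt 1 a with ha | ha
      -- Use a - X = (1 - X) + (a - 1) with a - 1 ≥ 0; a root a ≤ -1 is treated symmetrically.
      · have := ih q.natDegree (by omega) (L ∘ₗ LinearMap.mulLeft ℝ (C a - X))
          (fun r => by
            have e1 := hsq L h₁ h₂ ((1 - X) * r)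
            have e2 := mul_nonneg (sub_nonneg.2 ha) (h₁ r)
            rw [← smul_eq_mul, ← map_smul] at e2
            refine (add_nonneg e1 e2).trans_eq ?_
            rw [← map_add, LinearMap.comp_apply, LinearMap.mulLeft_apply, smul_eq_C_mul, C_sub,
              C_1]
            congr 1
            ring)
          (fun r => by
            have e1 := hprod L h₁ h₂ r
            have e2 := mul_nonneg (sub_nonneg.2 ha) (h₂ r)
            rw [← smul_eq_mul, ← map_smul] at e2
            refine (add_nonneg e1 e2).trans_eq ?_
            rw [← map_add, LinearMap.comp_apply, LinearMap.mulLeft_apply, smul_eq_C_mul, C_sub,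
              C_1]
            congr 1
            ring) (-q) (hdense _ a fun s hs hsa => by
              have h3 : s < a := lt_of_le_of_ne (hs.2.trans ha) hsa
              have := hp s hs
              rw [eval_neg]
              nlinarith) (natDegree_neg q)
        convert this using 1
        rw [LinearMap.comp_apply, LinearMap.mulLeft_apply]
        congr 1
        ring
      rcases le_or_gt a (-1) with ha' | ha'
      · have := ih q.natDegree (by omega) (L ∘ₗ LinearMap.mulLeft ℝ (X - C a))
          (fun r => by
            have e1 := hprod L h₁ h₂ r
            have e2 := mul_nonneg (show 0 ≤ -1 - a by linarith) (h₁ r)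
            rw [← smul_eq_mul, ← map_smul] at e2
            refine (add_nonneg e1 e2).trans_eq ?_
            rw [← map_add, LinearMap.comp_apply, LinearMap.mulLeft_apply, smul_eq_C_mul, C_sub,
              C_neg, C_1]
            congr 1
            ring)
          (fun r => by
            have e1 := hsq L h₁ h₂ ((1 + X) * r)
            have e2 := mul_nonneg (show 0 ≤ -1 - a by linarith) (h₂ r)
            rw [← smul_eq_mul, ← map_smul] at e2
            refine (add_nonneg e1 e2).trans_eq ?_
            rw [← map_add, LinearMap.comp_apply, LinearMap.mulLeft_apply, smul_eq_C_mul, C_sub,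
              C_neg, C_1]
            congr 1
            ring) q (hdense _ a fun s hs hsa => by
              have h3 : a < s := lt_of_le_of_ne (ha'.trans hs.1) hsa.symm
              have := hp s hs
              nlinarith) rfl
        exact this
      -- At an interior root, q is ≤ 0 to the left and ≥ 0 to the right, so the root is at least
      -- double and the square (X - a)² can be moved into L.
      · have hqa : q.IsRoot a := by
          have hcont : Continuous fun s => q.eval s := q.continuous
          refine le_antisymm ?_ ?_
          · have : a ∈ closure (Set.Ioo (-1) a) := by
              rw [closure_Ioo ha'.ne]
              exact ⟨ha'.le, le_rfl⟩
            refine closure_minimal (t := {s | q.eval s ≤ 0}) (fun s hs => ?_)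
              (isClosed_le hcont continuous_const) this
            have := hp s ⟨hs.1.le, by linarith [hs.2]⟩
            have := hs.2
            by_contra h
            rw [Set.mem_ofPred_eq, not_le] at h
            nlinarith
          · have : a ∈ closure (Set.Ioo a 1) := by
              rw [closure_Ioo ha.ne]
              exact ⟨le_rfl, ha.le⟩
            refine closure_minimal (t := {s | 0 ≤ q.eval s}) (fun s hs => ?_)
              (isClosed_le continuous_const hcont) this
            have := hp s ⟨by linarith [hs.1], hs.2.le⟩
            have := hs.1
            by_contra h
            rw [Set.mem_ofPred_eq, not_le] at h
            nlinarith
        obtain ⟨r, rfl⟩ := dvd_iff_isRoot.2 hqa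
        have hrdeg : ((X - C a) * r).natDegree = r.natDegree + 1 := by
          rw [natDegree_mul (X_sub_C_ne_zero a) (right_ne_zero_of_mul hq0), natDegree_X_sub_C,
            add_comm]
        have := ih r.natDegree (by omega) (L ∘ₗ LinearMap.mulLeft ℝ ((X - C a) ^ 2))
          (fun t => by
            convert h₁ ((X - C a) * t) using 1
            rw [LinearMap.comp_apply, LinearMap.mulLeft_apply]
            congr 1
            ring)
          (fun t => by
            convert h₂ ((X - C a) * t) using 1
            rw [LinearMap.comp_apply, LinearMap.mulLeft_apply]
            congr 1
            ring) r (hdense _ a fun s hs hsa => by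
              have h3 := hp s hs
              simp only [eval_mul, eval_sub, eval_X, eval_C] at h3
              rw [← mul_assoc] at h3
              exact nonneg_of_mul_nonneg_right h3 (mul_self_pos.2 (sub_ne_zero.2 hsa))) rfl
        convert this using 1
        rw [LinearMap.comp_apply, LinearMap.mulLeft_apply]
        congr 1
        ring
    · obtain ⟨q, rfl⟩ := quadratic_dvd_of_aeval_eq_zero_im_ne_zero p hz him
      -- The quadratic factor of a nonreal root is a sum of two squares, each of which preserves the
      -- hypotheses.
      have hf : (X ^ 2 - C (2 * z.re) * X + C (‖z‖ ^ 2) : ℝ[X]) =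
          (X - C z.re) ^ 2 + C (z.im ^ 2) := by
        rw [Complex.sq_norm, Complex.normSq_apply]
        simp only [C_mul, C_add, C_pow, map_ofNat]
        ring
      rw [hf] at hp hp0 ih ⊢
      have hmonic : ((X - C z.re) ^ 2 + C (z.im ^ 2) : ℝ[X]).natDegree = 2 := by
        compute_degree!
      have hdeg2 : (((X - C z.re) ^ 2 + C (z.im ^ 2)) * q).natDegree = 2 + q.natDegree := by
        rw [natDegree_mul (left_ne_zero_of_mul hp0) (right_ne_zero_of_mul hp0), hmonic]
      have := ih q.natDegree (by omega)
        (L ∘ₗ LinearMap.mulLeft ℝ ((X - C z.re) ^ 2 + C (z.im ^ 2)))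
        (fun r => by
          refine (add_nonneg (h₁ ((X - C z.re) * r)) (h₁ (C z.im * r))).trans_eq ?_
          rw [← map_add, LinearMap.comp_apply, LinearMap.mulLeft_apply, C_pow]
          congr 1
          ring)
        (fun r => by
          refine (add_nonneg (h₂ ((X - C z.re) * r)) (h₂ (C z.im * r))).trans_eq ?_
          rw [← map_add, LinearMap.comp_apply, LinearMap.mulLeft_apply, C_pow]
          congr 1
          ring) q (fun s hs => by
            have h3 := hp s hs
            simp only [eval_mul, eval_sub, eval_X, eval_C, eval_add, eval_pow] at h3
            exact nonneg_of_mul_nonneg_right h3 (by positivity)) rfl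
      exact this

open Polynomial in
/-- The solution of the moment problem on `[-1, 1]`. -/
theorem Polynomial.exists_measure_icc_of_nonneg (L : ℝ[X] →ₗ[ℝ] ℝ)
    (hL : ∀ p : ℝ[X], (∀ s ∈ Set.Icc (-1 : ℝ) 1, 0 ≤ p.eval s) → 0 ≤ L p) :
    ∃ ν : MeasureTheory.Measure (Set.Icc (-1 : ℝ) 1), MeasureTheory.IsFiniteMeasure ν ∧
      ∀ p : ℝ[X], L p = ∫ s, p.eval (s : ℝ) ∂ν := by
  set A : ℝ[X] →ₗ[ℝ] C(Set.Icc (-1 : ℝ) 1, ℝ) :=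
    (toContinuousMapOnAlgHom (Set.Icc (-1 : ℝ) 1)).toLinearMap with hA
  have hAapp : ∀ p s, A p s = p.eval (s : ℝ) := fun p s => by simp [hA]
  have hinj : Function.Injective A := by
    intro p q hpq
    refine Polynomial.eq_of_infinite_eval_eq p q
      ((Set.Icc_infinite (show (-1 : ℝ) < 1 by norm_num)).mono fun s hs => ?_)
    have := congrArg (fun f => f ⟨s, hs⟩) hpq
    exact (hAapp p ⟨s, hs⟩).symm.trans (this.trans (hAapp q ⟨s, hs⟩))
  set e := LinearEquiv.ofInjective A hinj
  -- The extension to all continuous functions needs each y to become nonnegative after adding a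
  -- polynomial: the constant ‖y‖ does this.
  obtain ⟨g, hg, hgpos⟩ := riesz_extension
    (PointedCone.positive ℝ C(Set.Icc (-1 : ℝ) 1, ℝ))
    ⟨LinearMap.range A, L ∘ₗ e.symm.toLinearMap⟩
    (by
      rintro ⟨_, p, rfl⟩ hx
      have : e.symm ⟨A p, LinearMap.mem_range_self A p⟩ = p := e.symm_apply_apply p
      change 0 ≤ L (e.symm ⟨A p, LinearMap.mem_range_self A p⟩)
      rw [this]
      refine hL p fun s hs => ?_
      have h0 : 0 ≤ A p := by simpa using hx
      have := h0 ⟨s, hs⟩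
      simpa [hAapp] using this)
    (fun y => by
      refine ⟨⟨A (C ‖y‖), LinearMap.mem_range_self A _⟩, ?_⟩
      rw [PointedCone.mem_positive]
      intro s
      have := neg_le_of_abs_le (y.norm_coe_le_norm s)
      simp [hAapp]
      linarith)
  have hgA : ∀ p, g (A p) = L p := fun p => by
    have h1 : e.symm ⟨A p, LinearMap.mem_range_self A p⟩ = p := e.symm_apply_apply p
    refine (hg ⟨A p, LinearMap.mem_range_self A p⟩).trans ?_
    exact congrArg L h1
  let Λ : CompactlySupportedContinuousMap (Set.Icc (-1 : ℝ) 1) ℝ →ₚ[ℝ] ℝ :=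
    PositiveLinearMap.mk₀
      { toFun := fun f => g f.toContinuousMap
        map_add' := fun f₁ f₂ => map_add g f₁.toContinuousMap f₂.toContinuousMap
        map_smul' := fun c f => map_smul g c f.toContinuousMap }
      (fun f hf => hgpos _ (by
        rw [PointedCone.mem_positive]
        exact hf))
  refine ⟨RealRMK.rieszMeasure Λ, inferInstance, fun p => ?_⟩
  have h := RealRMK.integral_rieszMeasure Λ
    ⟨A p, HasCompactSupport.of_compactSpace _⟩
  rw [← hgA]
  refine h.symm.trans (MeasureTheory.integral_congr_ae (.of_forall fun s => ?_))
  exact hAapp p s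

/-! ### Test elements and the inequalities for φ -/

/-- The element `h_β g_{t₁} ⋯ g_{tₗ}` attached to `β` and an index `a`, in terms of an
enumeration `e` of the generators. -/
def freshWord {ι : Type*} (e : Bool ⊕ (ι × ℕ) → ℕ) (β : Bool) (a : ι) (l : ℕ) : FreeGroup ℕ :=
  mk [(e (.inl β), true)] * mk ((List.range l).map fun t => (e (.inr (a, t)), true))

theorem nodup_map_fst_range {ι : Type*} {e : Bool ⊕ (ι × ℕ) → ℕ} (he : Function.Injective e)
    (a : ι) (l : ℕ) :
    (((List.range l).map fun t => (e (.inr (a, t)), true)).map Prod.fst).Nodup := by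
  rw [List.map_map]
  refine List.Nodup.map (fun s t h => ?_) List.nodup_range
  simpa using he h

theorem l2LengthSq_mk_of_nodup {L : List (ℕ × Bool)} (hL : (L.map Prod.fst).Nodup) :
    l2LengthSq (mk L) = L.length :=
  l2LengthSq_mk_of_isChain_ne (List.pairwise_map.1 hL).isChain

theorem map_fst_invRev (L : List (ℕ × Bool)) :
    (invRev L).map Prod.fst = (L.map Prod.fst).reverse := by
  simp [invRev]

/-- Distinct indices use disjoint generators, so only the head letters can cancel: they do when β =
γ and otherwise add two letters. All remaining syllables have exponent ±1. -/
theorem l2LengthSq_freshWord {ι : Type*} {e : Bool ⊕ (ι × ℕ) → ℕ} (he : Function.Injective e)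
    {β γ : Bool} {a b : ι} (hab : a ≠ b) (l m : ℕ) :
    l2LengthSq ((freshWord e β a l)⁻¹ * freshWord e γ b m) =
      l + m + if β = γ then 0 else 2 := by
  set A := (List.range l).map fun t => (e (.inr (a, t)), true) with hA
  set B := (List.range m).map fun t => (e (.inr (b, t)), true) with hB
  have hAn : (A.map Prod.fst).Nodup := nodup_map_fst_range he a l
  have hBn : (B.map Prod.fst).Nodup := nodup_map_fst_range he b m
  have hAm : ∀ x ∈ A.map Prod.fst, ∃ t, x = e (.inr (a, t)) := by
    intro x hx
    simp only [hA, List.map_map, List.mem_map] at hx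
    obtain ⟨t, -, rfl⟩ := hx
    exact ⟨t, rfl⟩
  have hBm : ∀ x ∈ B.map Prod.fst, ∃ t, x = e (.inr (b, t)) := by
    intro x hx
    simp only [hB, List.map_map, List.mem_map] at hx
    obtain ⟨t, -, rfl⟩ := hx
    exact ⟨t, rfl⟩
  have hdisj : List.Disjoint (A.map Prod.fst) (B.map Prod.fst) := by
    intro x hx hx'
    obtain ⟨t, rfl⟩ := hAm x hx
    obtain ⟨u, hu⟩ := hBm _ hx'
    have := he hu
    simp_all
  have hinl : ∀ (δ : Bool), e (.inl δ) ∉ A.map Prod.fst ∧ e (.inl δ) ∉ B.map Prod.fst := by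
    refine fun δ => ⟨fun h => ?_, fun h => ?_⟩
    · obtain ⟨t, ht⟩ := hAm _ h
      simpa using he ht
    · obtain ⟨t, ht⟩ := hBm _ h
      simpa using he ht
  have hAl : A.length = l := by simp [hA]
  have hBl : B.length = m := by simp [hB]
  simp only [freshWord, ← hA, ← hB]
  by_cases hβ : β = γ
  · subst hβ
    rw [show (mk [(e (.inl β), true)] * mk A)⁻¹ * (mk [(e (.inl β), true)] * mk B) =
      (mk A)⁻¹ * mk B by group, inv_mk, mul_mk, l2LengthSq_mk_of_nodup]
    · simp [invRev_length, hAl, hBl]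
    · rw [List.map_append, map_fst_invRev, List.nodup_append', List.nodup_reverse]
      exact ⟨hAn, hBn, by simpa [List.Disjoint] using hdisj⟩
  · rw [mul_mk, mul_mk, inv_mk, mul_mk, l2LengthSq_mk_of_nodup]
    · simp [invRev_length, hAl, hBl, hβ]
      ring
    · have hne : e (.inl β) ≠ e (.inl γ) := fun h => hβ (by simpa using he h)
      have h1 := hinl β
      have h2 := hinl γ
      rw [List.map_append, map_fst_invRev, List.nodup_append', List.nodup_reverse]
      simp only [List.singleton_append, List.map_cons, List.nodup_cons, List.disjoint_left,
        List.mem_reverse, List.mem_cons, not_or]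
      refine ⟨⟨h1.1, hAn⟩, ⟨h2.2, hBn⟩, fun x hx => ?_⟩
      rcases hx with rfl | hx
      · exact ⟨hne, h1.2⟩
      · exact ⟨fun h => h2.1 (h ▸ hx), fun h => hdisj hx h⟩

open scoped ComplexOrder in
theorem IsCondNegDef.sum_nonpos {G ι : Type*} [Group G] [Fintype ι] {ψ : G → ℂ}
    (hψ : IsCondNegDef ψ) {φ : ι → ι → ℝ} (x : ι → G)
    (hφ : ∀ j k, ψ ((x j)⁻¹ * x k) = φ j k) (c : ι → ℝ) (hc : ∑ j, c j = 0) :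
    ∑ j, ∑ k, c j * c k * φ j k ≤ 0 := by
  have e := Fintype.equivFin ι
  have h := hψ.2 (Fintype.card ι) (fun j => x (e.symm j)) (fun j => (c (e.symm j) : ℂ)) (by
    rw [e.symm.sum_comp (fun j => (c j : ℂ))]
    exact_mod_cast hc)
  simp only [hφ, Complex.conj_ofReal] at h
  rw [← Complex.real_le_real]
  push_cast
  refine le_of_eq_of_le ?_ h
  rw [← e.symm.sum_comp]
  refine Finset.sum_congr rfl fun j _ => ?_
  rw [← e.symm.sum_comp]

/-- The kernel is wrong for ψ only on the diagonal, where ψ(e) = 0. Repeating each index M times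
with fresh generators makes the main term of order M² and the diagonal correction of order M, so the
latter disappears in the limit. -/
theorem IsCondNegDef.sum_pair_nonpos {ψ : FreeGroup ℕ → ℂ} (hψ : IsCondNegDef ψ) {φ : ℕ → ℝ}
    (hφ : ∀ g, ψ g = φ (l2LengthSq g)) (hφ0 : φ 0 = 0) {n : ℕ} (c : Bool × Fin n → ℝ)
    (hc : ∑ p, c p = 0) :
    ∑ p, ∑ q, c p * c q * φ (p.2 + q.2 + if p.1 = q.1 then 0 else 2) ≤ 0 := by
  classical
  set K : Bool × Fin n → Bool × Fin n → ℝ :=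
    fun p q => φ (p.2 + q.2 + if p.1 = q.1 then 0 else 2) with hK
  have key : ∀ M : ℕ, 1 ≤ M → M * (∑ p, ∑ q, c p * c q * K p q) ≤ ∑ p, c p * c p * K p p := by
    intro M hM
    obtain ⟨e, he⟩ := exists_injective_nat (Bool ⊕ (((Bool × Fin n) × Fin M) × ℕ))
    have h := hψ.sum_nonpos (ι := (Bool × Fin n) × Fin M)
      (φ := fun a b => K a.1 b.1 - if a = b then K a.1 a.1 else 0)
      (fun a => freshWord e a.1.1 a a.1.2) (by
        rintro ⟨p, k⟩ ⟨q, l⟩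
        rw [hφ]
        by_cases hab : (p, k) = (q, l)
        · rw [if_pos hab]
          obtain ⟨rfl, rfl⟩ := Prod.mk.inj hab
          rw [inv_mul_cancel, sub_self]
          exact congrArg _ hφ0
        · rw [l2LengthSq_freshWord he hab]
          simp [hab, hK])
      (fun a => c a.1) (by simp [Fintype.sum_prod_type_right, hc])
    have h2 : ∑ a : (Bool × Fin n) × Fin M, ∑ b : (Bool × Fin n) × Fin M, c a.1 * c b.1 *
        (K a.1 b.1 - if a = b then K a.1 a.1 else 0) =
        M * (M * (∑ p, ∑ q, c p * c q * K p q) - ∑ p, c p * c p * K p p) := by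
      rw [Fintype.sum_prod_type]
      have h3 : ∀ (p : Bool × Fin n) (k : Fin M), ∑ b : (Bool × Fin n) × Fin M, c p * c b.1 *
          (K p b.1 - if (p, k) = b then K p p else 0) =
          M * (∑ q, c p * c q * K p q) - c p * c p * K p p := by
        intro p k
        simp only [mul_sub, Finset.sum_sub_distrib, mul_ite, mul_zero]
        rw [Finset.sum_ite_eq, if_pos (Finset.mem_univ _), Fintype.sum_prod_type_right]
        simp
      simp only [h3, Finset.sum_const, Finset.card_univ, Fintype.card_fin, nsmul_eq_mul]
      rw [← Finset.mul_sum, Finset.sum_sub_distrib, ← Finset.mul_sum]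
    rw [h2] at h
    have hM' : (0 : ℝ) < M := by exact_mod_cast hM
    have := nonpos_of_mul_nonpos_right h hM'
    linarith
  by_contra! hS
  set S := ∑ p, ∑ q, c p * c q * K p q with hSdef
  obtain ⟨M, hM⟩ := exists_nat_gt ((∑ p, c p * c p * K p p) / S)
  rw [div_lt_iff₀ hS] at hM
  have := key (M + 1) (by omega)
  push_cast at this
  nlinarith

open Polynomial in
theorem Polynomial.basisMonomials_constr_mul (φ : ℕ → ℝ) {n : ℕ} {p q : ℝ[X]}
    (hp : p.natDegree < n) (hq : q.natDegree < n) (m : ℕ) :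
    (basisMonomials ℝ).constr ℝ φ (p * q * X ^ m) =
      ∑ i : Fin n, ∑ j : Fin n, p.coeff i * q.coeff j * φ (i + j + m) := by
  have hX : ∀ k, (basisMonomials ℝ).constr ℝ φ (X ^ k) = φ k := fun k => by
    rw [← monomial_one_right_eq_X_pow, ← congrFun (coe_basisMonomials ℝ) k,
      Module.Basis.constr_basis]
  conv_lhs => rw [p.as_sum_range' n hp, q.as_sum_range' n hq]
  rw [Finset.sum_mul_sum, Finset.sum_mul, map_sum, Finset.sum_range]
  refine Finset.sum_congr rfl fun i _ => ?_
  rw [Finset.sum_mul, map_sum, Finset.sum_range]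
  refine Finset.sum_congr rfl fun j _ => ?_
  rw [monomial_mul_monomial, ← C_mul_X_pow_eq_monomial, mul_assoc, ← pow_add, ← smul_eq_C_mul,
    map_smul, hX, smul_eq_mul]

-- The coefficients of p and q serve as weights for the two values of β, and p(1) + q(1) = 0 says
-- that the weights sum to zero.
open Polynomial in
theorem IsCondNegDef.basisMonomials_constr_nonpos {ψ : FreeGroup ℕ → ℂ} (hψ : IsCondNegDef ψ)
    {φ : ℕ → ℝ} (hφ : ∀ g, ψ g = φ (l2LengthSq g)) (hφ0 : φ 0 = 0) (p q : ℝ[X])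
    (hpq : p.eval 1 + q.eval 1 = 0) :
    (basisMonomials ℝ).constr ℝ φ (p ^ 2 + q ^ 2 + 2 * (p * q * X ^ 2)) ≤ 0 := by
  set n := max p.natDegree q.natDegree + 1
  have hp : p.natDegree < n := by omega
  have hq : q.natDegree < n := by omega
  have h := hψ.sum_pair_nonpos hφ hφ0 (n := n)
    (fun a => if a.1 then p.coeff a.2 else q.coeff a.2) (by
      rw [Fintype.sum_prod_type]
      rw [eval_eq_sum_range' hp, eval_eq_sum_range' hq, Finset.sum_range, Finset.sum_range] at hpq
      simpa using hpq)
  refine le_of_eq_of_le ?_ h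
  have e1 : p ^ 2 + q ^ 2 + 2 * (p * q * X ^ 2) =
      p * p * X ^ 0 + q * p * X ^ 2 + (p * q * X ^ 2 + q * q * X ^ 0) := by ring
  rw [e1, map_add, map_add, map_add, basisMonomials_constr_mul φ hp hp,
    basisMonomials_constr_mul φ hq hp, basisMonomials_constr_mul φ hp hq,
    basisMonomials_constr_mul φ hq hq]
  simp only [Fintype.sum_prod_type, Fintype.sum_bool, Finset.sum_add_distrib]
  simp

/-! ### Existence of the measure -/

open Polynomial in
theorem IsCondNegDef.exists_hasLevyKhintchineForm {ψ : FreeGroup ℕ → ℂ} (hψ : IsCondNegDef ψ)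
    (hrad : IsL2Radial ψ) (h1 : ψ 1 = 0) :
    ∃ ν : MeasureTheory.Measure (Set.Icc (-1 : ℝ) 1),
      MeasureTheory.IsFiniteMeasure ν ∧ HasLevyKhintchineForm ψ ν := by
  have hrad' : ∀ g h, l2LengthSq g = l2LengthSq h → ψ g = ψ h := fun g h hgh =>
    hrad g h (by rw [l2Length, l2Length, hgh])
  -- g and g⁻¹ have equal length, so radiality and ψ(g⁻¹) = conj ψ(g) make ψ real.
  have hreal : ∀ g, ψ g = ((ψ g).re : ℂ) := fun g => by
    refine (Complex.conj_eq_iff_re.1 ?_).symm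
    rw [← hψ.1, hrad' _ _ (l2LengthSq_inv g)]
  choose w hw using exists_l2LengthSq_eq
  set φ : ℕ → ℝ := fun m => (ψ (w m)).re
  have hφ : ∀ g, ψ g = φ (l2LengthSq g) := fun g => by
    rw [hrad' g (w (l2LengthSq g)) (hw _).symm]
    exact hreal _
  have hone : l2LengthSq 1 = 0 := rfl
  have hφ0 : φ 0 = 0 := by
    have := hφ 1
    rw [hone, h1] at this
    exact_mod_cast this.symm
  set Φ : ℝ[X] →ₗ[ℝ] ℝ := (basisMonomials ℝ).constr ℝ φ with hΦ
  have hΦX : ∀ m, Φ (X ^ m) = φ m := fun m => by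
    rw [← monomial_one_right_eq_X_pow, ← congrFun (coe_basisMonomials ℝ) m, hΦ,
      Module.Basis.constr_basis]
  have hneg := hψ.basisMonomials_constr_nonpos hφ hφ0
  obtain ⟨ν, hν, hνL⟩ := exists_measure_icc_of_nonneg (Φ ∘ₗ LinearMap.mulLeft ℝ (X - 1))
    (map_nonneg_of_eval_nonneg_icc _
      (fun q => by
        have h := hneg ((1 - X) * q) 0 (by simp)
        rw [LinearMap.comp_apply, LinearMap.mulLeft_apply, ← neg_nonpos, ← map_neg]
        refine le_of_eq_of_le ?_ h
        congr 1
        ring)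
      (fun q => by
        have h := hneg q (-q) (by simp)
        have e1 : q ^ 2 + (-q) ^ 2 + 2 * (q * -q * X ^ 2) =
            (-2 : ℝ) • ((X - 1) * ((1 + X) * q ^ 2)) := by
          rw [neg_smul, two_smul]
          ring
        rw [e1, map_smul, smul_eq_mul] at h
        rw [LinearMap.comp_apply, LinearMap.mulLeft_apply]
        linarith))
  refine ⟨ν, hν, fun g => ?_⟩
  rw [hφ]
  congr 1
  have h2 := hνL (∑ i ∈ Finset.range (l2LengthSq g), X ^ i)
  rw [LinearMap.comp_apply, LinearMap.mulLeft_apply, mul_geom_sum, map_sub, hΦX,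
    ← pow_zero (X : ℝ[X]), hΦX, hφ0, sub_zero] at h2
  rw [h2]
  refine MeasureTheory.integral_congr_ae (.of_forall fun s => ?_)
  simp [levyKernel_eq_sum_pow, eval_finsetSum]

theorem theorem1p3 (ψ : FreeGroup ℕ → ℂ) (hrad : IsL2Radial ψ) (h1 : ψ 1 = 0) :
    (IsCondNegDef ψ ↔
      ∃ ν : MeasureTheory.Measure (Set.Icc (-1 : ℝ) 1),
        MeasureTheory.IsFiniteMeasure ν ∧ HasLevyKhintchineForm ψ ν) ∧
    ∀ ν₁ ν₂ : MeasureTheory.Measure (Set.Icc (-1 : ℝ) 1),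
      MeasureTheory.IsFiniteMeasure ν₁ → MeasureTheory.IsFiniteMeasure ν₂ →
      HasLevyKhintchineForm ψ ν₁ → HasLevyKhintchineForm ψ ν₂ → ν₁ = ν₂ := by
  refine ⟨⟨fun h => h.exists_hasLevyKhintchineForm hrad h1, ?_⟩, ?_⟩
  · rintro ⟨ν, hν, h⟩
    exact h.isCondNegDef
  · intro ν₁ ν₂ _ _ h₁ h₂
    exact h₁.measure_unique h₂
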